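/- (Mean Value Theorem for Hausdorff dimension.) Let $X$ be a separable complete metric space, and let $\dim_H(E)\in[0,\infty]$ denote the Hausdorff dimension of a subset $E\subset X$. For every non-negative real number $d<\dim_H(X)$ (where $\dim_H(X)=\infty$ is allowed) the space $X$ contains a compact subset $K\subset X$ of Hausdorff dimension $\dim_H(K)=d$. -/

import Mathlib

open scoped NNReal ENNReal

open Metric MeasureTheory Filter Topology

/-! For `d = 0` a point suffices. For `d > 0`, `d < dimH X` makes `μH[d]` infinite, so the
`d`-dimensional Hausdorff content of `X` is nonzero. Content-almost every point is thick: it has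
arbitrarily small balls of radius `r` with content at least `r ^ d / 2`. Inside a thick ball of
radius `r` one finds finitely many separated thick balls of radius at most `r ^ 2` whose `d`-mass is
at least a fixed multiple of `r ^ d`, yet at most `2 * s ^ d` near any of their centres at each
scale `s` up to `5 * r` (`ThickBall.exists_children`). Otherwise a double Vitali covering
(`content_le_of_forall_packed`) would make the content too small.

Iterating gives a Cantor set. Each generation costs a constant factor in the mass estimates, but
radii at least square from parent to child, so a small power `r ^ |d - e|` absorbs it for every `e ≠
d`. Hence sums of `r ^ e` stay bounded for `e > d` (`dimH_limitSet_le`), and the mass distribution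
principle holds for every `e < d` (`le_dimH_limitSet`). The dimension is therefore exactly `d`,
although no `d`-regular measure is constructed. -/

/-- A tree of nodes carrying a centre and a radius, such that the children of a node are separated,
satisfy a `d`-dimensional packing condition, and carry a fixed proportion of the `d`-dimensional
mass of their parent. -/
structure CantorScheme (X : Type*) [MetricSpace X] (d : ℝ) (T : Type*) where
  center : T → X
  radius : T → ℝ
  children : T → Finset T
  ratio : ℝ
  ratio_pos : 0 < ratio
  radius_pos : ∀ p, 0 < radius p
  radius_le : ∀ p, radius p ≤ 1 / 10
  radius_child : ∀ p, ∀ q ∈ children p, radius q ≤ radius p ^ 2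
  dist_child : ∀ p, ∀ q ∈ children p, dist (center q) (center p) ≤ radius p
  separated : ∀ p, ∀ q ∈ children p, ∀ q' ∈ children p, q ≠ q' →
    5 * radius q < dist (center q) (center q')
  packing : ∀ p, ∀ q ∈ children p, ∀ s, radius q ≤ s → s ≤ 5 * radius p →
    ∑ q' ∈ (children p).filter (fun q' => dist (center q') (center q) ≤ s), radius q' ^ d ≤ 2 * s ^ d
  mass : ∀ p, ratio * radius p ^ d ≤ ∑ q ∈ children p, radius q ^ d

/-! ### Cantor schemes: mass fractions, levels and the compact limit set. -/

namespace CantorScheme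

variable {X : Type*} [MetricSpace X] {d : ℝ} {T : Type*} (C : CantorScheme X d T)

/-- The closed ball in which all descendants of a node live. -/
def cell (p : T) : Set X := closedBall (C.center p) (2 * C.radius p)

/-- The total `d`-dimensional mass of the children of a node. -/
noncomputable def childMass (p : T) : ℝ := ∑ q ∈ C.children p, C.radius q ^ d

lemma childMass_pos (p : T) : 0 < C.childMass p :=
  (mul_pos C.ratio_pos (Real.rpow_pos_of_pos (C.radius_pos p) d)).trans_le (C.mass p)

lemma children_nonempty (p : T) : (C.children p).Nonempty := by
  by_contra h
  have := C.childMass_pos p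
  simp [childMass, Finset.not_nonempty_iff_eq_empty.1 h] at this

lemma radius_child_le {p q : T} (h : q ∈ C.children p) : C.radius q ≤ C.radius p / 10 := by
  have := C.radius_child p q h
  nlinarith [C.radius_pos p, C.radius_le p]

lemma cell_child_subset {p q : T} (h : q ∈ C.children p) : C.cell q ⊆ C.cell p := by
  apply closedBall_subset_closedBall'
  linarith [C.radius_child_le h, C.dist_child p q h, C.radius_pos p]

/-- All children lie within `2 * radius p` of any one of them, so packing at that scale counts them
all. -/
lemma childMass_le {p : T} : C.childMass p ≤ 2 * (2 * C.radius p) ^ d := by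
  obtain ⟨q, hq⟩ := C.children_nonempty p
  have hp := C.radius_pos p
  have := C.packing p q hq (2 * C.radius p) (by linarith [C.radius_child_le hq]) (by linarith)
  rwa [Finset.filter_true_of_mem] at this
  intro q' hq'
  linarith [dist_triangle_right (C.center q') (C.center q) (C.center p), C.dist_child p q hq,
    C.dist_child p q' hq']

open Classical in
/-- The proportion of the mass of a node carried by its descendants of depth `n` whose cells
meet `S`. -/
noncomputable def meetFraction (S : Set X) : ℕ → T → ℝ
  | 0, p => if (C.cell p ∩ S).Nonempty then 1 else 0
  | n + 1, p => (∑ q ∈ C.children p, C.radius q ^ d * meetFraction S n q) / C.childMass p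

lemma meetFraction_nonneg (S : Set X) (n : ℕ) (p : T) : 0 ≤ C.meetFraction S n p := by
  induction n generalizing p with
  | zero => rw [meetFraction]; split_ifs <;> norm_num
  | succ n ih =>
    exact div_nonneg (Finset.sum_nonneg fun q _ =>
      mul_nonneg (Real.rpow_nonneg (C.radius_pos q).le d) (ih q)) (C.childMass_pos p).le

lemma meetFraction_le_one (S : Set X) (n : ℕ) (p : T) : C.meetFraction S n p ≤ 1 := by
  induction n generalizing p with
  | zero => rw [meetFraction]; split_ifs <;> norm_num
  | succ n ih =>
    rw [meetFraction, div_le_one (C.childMass_pos p)]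
    exact Finset.sum_le_sum fun q _ =>
      mul_le_of_le_one_right (Real.rpow_nonneg (C.radius_pos q).le d) (ih q)

lemma meetFraction_eq_zero {S : Set X} {n : ℕ} {p : T} (h : ¬ (C.cell p ∩ S).Nonempty) :
    C.meetFraction S n p = 0 := by
  induction n generalizing p with
  | zero => rw [meetFraction, if_neg h]
  | succ n ih =>
    rw [meetFraction, Finset.sum_eq_zero, zero_div]
    intro q hq
    rw [ih (fun h' => h (h'.mono (Set.inter_subset_inter_left S (C.cell_child_subset hq)))),
      mul_zero]

/-- Finite subadditivity: together with `meetFraction_limitSet` it lets `meetFraction` play the role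
of a probability measure on the limit set. -/
lemma meetFraction_le_sum {ι : Type*} (I : Finset ι) (S : ι → Set X) {K : Set X}
    (hK : K ⊆ ⋃ i ∈ I, S i) (n : ℕ) (p : T) :
    C.meetFraction K n p ≤ ∑ i ∈ I, C.meetFraction (S i) n p := by
  induction n generalizing p with
  | zero =>
    by_cases h : (C.cell p ∩ K).Nonempty
    · obtain ⟨x, hx, hxK⟩ := h
      obtain ⟨i, hi, hxi⟩ := Set.mem_iUnion₂.1 (hK hxK)
      calc C.meetFraction K 0 p ≤ 1 := C.meetFraction_le_one K 0 p
        _ = C.meetFraction (S i) 0 p := by rw [meetFraction, if_pos ⟨x, hx, hxi⟩]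
        _ ≤ _ := Finset.single_le_sum (f := fun i => C.meetFraction (S i) 0 p)
          (fun j _ => C.meetFraction_nonneg (S j) 0 p) hi
    · rw [C.meetFraction_eq_zero h]
      exact Finset.sum_nonneg fun j _ => C.meetFraction_nonneg (S j) 0 p
  | succ n ih =>
    simp only [meetFraction]
    rw [← Finset.sum_div, Finset.sum_comm]
    refine div_le_div_of_nonneg_right (Finset.sum_le_sum fun q _ => ?_) (C.childMass_pos p).le
    rw [← Finset.mul_sum]
    exact mul_le_mul_of_nonneg_left (ih q) (Real.rpow_nonneg (C.radius_pos q).le d)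

/-- The finite set of nodes of level `n` below a root. -/
noncomputable def level (p₀ : T) : ℕ → Finset T := by
  classical exact fun n => Nat.rec {p₀} (fun _ L => L.biUnion C.children) n

lemma mem_level_zero {p₀ p : T} : p ∈ C.level p₀ 0 ↔ p = p₀ := by
  simp [level]

lemma mem_level_succ {p₀ q : T} {n : ℕ} :
    q ∈ C.level p₀ (n + 1) ↔ ∃ p ∈ C.level p₀ n, q ∈ C.children p := by
  simp [level]

lemma level_nonempty (p₀ : T) (n : ℕ) : (C.level p₀ n).Nonempty := by
  induction n with
  | zero => exact ⟨p₀, C.mem_level_zero.2 rfl⟩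
  | succ n ih =>
    obtain ⟨p, hp⟩ := ih
    obtain ⟨q, hq⟩ := C.children_nonempty p
    exact ⟨q, C.mem_level_succ.2 ⟨p, hp, hq⟩⟩

lemma radius_level_le {p₀ p : T} {n : ℕ} (h : p ∈ C.level p₀ n) :
    C.radius p ≤ (1 / 10 : ℝ) ^ n := by
  induction n generalizing p with
  | zero => simpa using (C.radius_le p).trans (by norm_num)
  | succ n ih =>
    obtain ⟨q, hq, hp⟩ := C.mem_level_succ.1 h
    rw [pow_succ]
    linarith [C.radius_child_le hp, ih hq]

lemma exists_radius_level_le (p₀ : T) {ε : ℝ} (hε : 0 < ε) :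
    ∃ N, ∀ n ≥ N, ∀ p ∈ C.level p₀ n, C.radius p ≤ ε := by
  obtain ⟨N, hN⟩ := exists_pow_lt_of_lt_one hε (by norm_num : (1 / 10 : ℝ) < 1)
  exact ⟨N, fun n hn p hp => (C.radius_level_le hp).trans
    ((pow_le_pow_of_le_one (by norm_num) (by norm_num) hn).trans hN.le)⟩

/-- The union of the cells of level `n`. -/
def stage (p₀ : T) (n : ℕ) : Set X := ⋃ p ∈ C.level p₀ n, C.cell p

/-- The limit set of the scheme below a root. -/
def limitSet (p₀ : T) : Set X := ⋂ n, C.stage p₀ n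

lemma stage_antitone (p₀ : T) : Antitone (C.stage p₀) := by
  refine antitone_nat_of_succ_le fun n x hx => ?_
  obtain ⟨q, hq, hx⟩ := Set.mem_iUnion₂.1 hx
  obtain ⟨p, hp, hqp⟩ := C.mem_level_succ.1 hq
  exact Set.mem_iUnion₂.2 ⟨p, hp, C.cell_child_subset hqp hx⟩

lemma isCompact_limitSet [CompleteSpace X] (p₀ : T) : IsCompact (C.limitSet p₀) := by
  refine isCompact_iff_totallyBounded_isComplete.2 ⟨?_, IsClosed.isComplete ?_⟩
  · rw [totallyBounded_iff]
    intro ε hε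
    obtain ⟨N, hN⟩ := C.exists_radius_level_le p₀ (ε := ε / 4) (by positivity)
    refine ⟨C.center '' (C.level p₀ N), (C.level p₀ N).finite_toSet.image _, fun x hx => ?_⟩
    obtain ⟨p, hp, hx⟩ := Set.mem_iUnion₂.1 (Set.mem_iInter.1 hx N)
    refine Set.mem_iUnion₂.2 ⟨C.center p, Set.mem_image_of_mem _ hp, ?_⟩
    have := hN N le_rfl p hp
    have hx' : dist x (C.center p) ≤ 2 * C.radius p := hx
    rw [mem_ball]; linarith
  · exact isClosed_iInter fun n => (C.level p₀ n).finite_toSet.isClosed_biUnion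
      fun p _ => isClosed_closedBall

/-- The centres along any infinite branch below `p` form a Cauchy sequence, and its limit lies in
all the cells of the branch. -/
lemma cell_inter_limitSet_nonempty [CompleteSpace X] {p₀ p : T} {n : ℕ} (h : p ∈ C.level p₀ n) :
    (C.cell p ∩ C.limitSet p₀).Nonempty := by
  choose g hg using C.children_nonempty
  have hlev : ∀ m, g^[m] p ∈ C.level p₀ (n + m) := by
    intro m
    induction m with
    | zero => exact h
    | succ m ih =>
      rw [Function.iterate_succ_apply']
      exact C.mem_level_succ.2 ⟨_, ih, hg _⟩
  have hanti : Antitone fun m => C.cell (g^[m] p) := antitone_nat_of_succ_le fun m => by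
    rw [Function.iterate_succ_apply']
    exact C.cell_child_subset (hg _)
  have hmem : ∀ m, C.center (g^[m] p) ∈ C.cell (g^[m] p) := fun m =>
    mem_closedBall_self (by linarith [C.radius_pos (g^[m] p)])
  have hcau : CauchySeq fun m => C.center (g^[m] p) := by
    refine Metric.cauchySeq_iff'.2 fun ε hε => ?_
    obtain ⟨N, hN⟩ := C.exists_radius_level_le p₀ (ε := ε / 4) (by positivity)
    refine ⟨N, fun m hm => ?_⟩
    have h1 : dist (C.center (g^[m] p)) (C.center (g^[N] p)) ≤ 2 * C.radius (g^[N] p) :=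
      hanti hm (hmem m)
    have h2 := hN (n + N) (by omega) _ (hlev N)
    linarith
  obtain ⟨x, hx⟩ := cauchySeq_tendsto_of_complete hcau
  have hxm : ∀ m, x ∈ C.cell (g^[m] p) := fun m =>
    isClosed_closedBall.mem_of_tendsto hx (eventually_atTop.2 ⟨m, fun k hk => hanti hk (hmem k)⟩)
  refine ⟨x, hxm 0, Set.mem_iInter.2 fun m => ?_⟩
  exact C.stage_antitone p₀ (Nat.le_add_left m n) (Set.mem_iUnion₂.2 ⟨_, hlev m, hxm m⟩)

lemma meetFraction_limitSet [CompleteSpace X] {p₀ p : T} {m : ℕ} (h : p ∈ C.level p₀ m) (n : ℕ) :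
    C.meetFraction (C.limitSet p₀) n p = 1 := by
  induction n generalizing p m with
  | zero => rw [meetFraction, if_pos (C.cell_inter_limitSet_nonempty h)]
  | succ n ih =>
    rw [meetFraction, div_eq_one_iff_eq (C.childMass_pos p).ne']
    exact Finset.sum_congr rfl fun q hq => by
      rw [ih (C.mem_level_succ.2 ⟨p, h, hq⟩), mul_one]

lemma dist_le_of_touch {S : Set X} {s : ℝ} (hS : ∀ x ∈ S, ∀ y ∈ S, dist x y ≤ s) {q q' : T}
    (hq : (C.cell q ∩ S).Nonempty) (hq' : (C.cell q' ∩ S).Nonempty) :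
    dist (C.center q) (C.center q') ≤ 2 * C.radius q + s + 2 * C.radius q' := by
  obtain ⟨x, hx, hxS⟩ := hq
  obtain ⟨y, hy, hyS⟩ := hq'
  have hx' : dist x (C.center q) ≤ 2 * C.radius q := hx
  have hy' : dist y (C.center q') ≤ 2 * C.radius q' := hy
  have := dist_triangle4 (C.center q) x y (C.center q')
  rw [dist_comm x] at hx'
  linarith [hS x hxS y hyS]

end CantorScheme

/-! ### The mass distribution estimate below dimension `d`. -/

namespace CantorScheme

variable {X : Type*} [MetricSpace X] {d : ℝ} {T : Type*} (C : CantorScheme X d T)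

/-- The constant in the mass distribution estimate `meetFraction_mul_le`. -/
noncomputable def distortion : ℝ := max 1 (2 * 5 ^ d / C.ratio)

lemma meetFraction_le_of_small {S : Set X} {s e : ℝ} (hs : 0 < s) (hed : e < d)
    (hS : ∀ x ∈ S, ∀ y ∈ S, dist x y ≤ s) (n : ℕ) {p : T} (hsp : s ≤ C.radius p)
    (hsmall : ∀ q ∈ C.children p, (C.cell q ∩ S).Nonempty → C.radius q ≤ s) :
    C.meetFraction S (n + 1) p * C.radius p ^ e ≤ C.distortion * s ^ e := by
  classical
  have hr := C.radius_pos p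
  have hΛ : 0 < C.distortion := zero_lt_one.trans_le (le_max_left _ _)
  rcases ((C.children p).filter fun q => (C.cell q ∩ S).Nonempty).eq_empty_or_nonempty with h | h
  · rw [meetFraction, Finset.sum_eq_zero, zero_div, zero_mul]
    · positivity
    · intro q hq
      rw [C.meetFraction_eq_zero, mul_zero]
      intro hqS
      exact Finset.filter_eq_empty_iff.1 h hq hqS
  obtain ⟨q₀, h₀⟩ := h
  obtain ⟨h₀, h₀S⟩ := Finset.mem_filter.1 h₀
  have hsum : ∑ q ∈ C.children p, C.radius q ^ d * C.meetFraction S n q ≤ 2 * (5 * s) ^ d := by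
    -- Touching children have radius at most `s`, so their centres lie within `2s + s + 2s = 5s` of
    -- that of `q₀`.
    refine le_trans ?_ (C.packing p q₀ h₀ (5 * s) (by linarith [hsmall q₀ h₀ h₀S]) (by linarith))
    rw [Finset.sum_filter]
    refine Finset.sum_le_sum fun q hq => ?_
    have hqd := Real.rpow_nonneg (C.radius_pos q).le d
    split_ifs with hq0
    · exact mul_le_of_le_one_right hqd (C.meetFraction_le_one S n q)
    · rw [C.meetFraction_eq_zero, mul_zero]
      intro hqS
      have := C.dist_le_of_touch hS hqS h₀S
      linarith [hsmall q hq hqS, hsmall q₀ h₀ h₀S]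
  have hW : C.meetFraction S (n + 1) p ≤ 2 * (5 * s) ^ d / (C.ratio * C.radius p ^ d) := by
    rw [meetFraction]
    exact div_le_div₀ (by positivity) hsum
      (mul_pos C.ratio_pos (Real.rpow_pos_of_pos hr d)) (C.mass p)
  have hρ := C.ratio_pos
  calc C.meetFraction S (n + 1) p * C.radius p ^ e
      ≤ 2 * (5 * s) ^ d / (C.ratio * C.radius p ^ d) * C.radius p ^ e := by gcongr
    _ = 2 * 5 ^ d / C.ratio * s ^ e * (s / C.radius p) ^ (d - e) := by
      rw [Real.mul_rpow (by norm_num) hs.le, Real.div_rpow hs.le hr.le, Real.rpow_sub hs,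
        Real.rpow_sub hr]
      field_simp
    _ ≤ 2 * 5 ^ d / C.ratio * s ^ e * 1 := by
      gcongr
      exact Real.rpow_le_one (by positivity) ((div_le_one hr).2 hsp) (by linarith)
    _ ≤ C.distortion * s ^ e := by
      rw [mul_one]
      gcongr
      exact le_max_right _ _

/-- Descend while some child larger than `s` touches `S`: it is then the only touching child, and
the factor `ratio` lost on passing to it is absorbed by the squaring of radii, so the constant does
not depend on `n`. The descent ends with `meetFraction_le_of_small`, or with the trivial bound by
`1` once `radius p ≤ s`, which `hn` forces at depth `0`. -/
lemma meetFraction_mul_le {S : Set X} {s e : ℝ} (hs : 0 < s) (he : 0 ≤ e) (hed : e < d)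
    (hS : ∀ x ∈ S, ∀ y ∈ S, dist x y ≤ s) (n : ℕ) (p : T)
    (hn : (1 / 10 : ℝ) ^ n * C.radius p ≤ s) (hp : C.radius p ^ (d - e) ≤ C.ratio) :
    C.meetFraction S n p * C.radius p ^ e ≤ C.distortion * s ^ e := by
  have hΛ : 1 ≤ C.distortion := le_max_left _ _
  induction n generalizing p with
  | zero =>
    have hr := C.radius_pos p
    rw [pow_zero, one_mul] at hn
    have := C.meetFraction_le_one S 0 p
    gcongr
    exact this.trans hΛ
  | succ n ih =>
    have hr := C.radius_pos p
    by_cases hsp : C.radius p ≤ s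
    · have := C.meetFraction_le_one S (n + 1) p
      gcongr
      exact this.trans hΛ
    push Not at hsp
    by_cases hsmall : ∀ q ∈ C.children p, (C.cell q ∩ S).Nonempty → C.radius q ≤ s
    · exact C.meetFraction_le_of_small hs hed hS n hsp.le hsmall
    push Not at hsmall
    obtain ⟨q, hq, hqS, hqs⟩ := hsmall
    have hqr := C.radius_pos q
    have hqp := C.radius_child_le hq
    have hqq : C.radius q ^ (d - e) ≤ C.ratio * C.radius p ^ (d - e) := calc
      C.radius q ^ (d - e) ≤ (C.radius p ^ 2) ^ (d - e) :=
        Real.rpow_le_rpow hqr.le (C.radius_child p q hq) (by linarith)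
      _ = C.radius p ^ (d - e) * C.radius p ^ (d - e) := by
        rw [sq, Real.mul_rpow hr.le hr.le]
      _ ≤ _ := by gcongr
    have hsum : ∑ q' ∈ C.children p, C.radius q' ^ d * C.meetFraction S n q'
        = C.radius q ^ d * C.meetFraction S n q := by
      refine Finset.sum_eq_single q (fun q' hq' hne => ?_) (fun h => (h hq).elim)
      rw [C.meetFraction_eq_zero, mul_zero]
      intro hq'S
      -- Touching gives distance below `3 * radius q + 2 * radius q'`, while separation in both
      -- orders gives more than five times the larger radius.
      have h1 := C.dist_le_of_touch hS hqS hq'S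
      have h2 := C.separated p q hq q' hq' hne.symm
      have h3 := C.separated p q' hq' q hq hne
      rw [dist_comm] at h3
      linarith
    have hIH := ih q (by rw [pow_succ] at hn; nlinarith [pow_pos (by norm_num : (0 : ℝ) < 1 / 10) n])
      ((Real.rpow_le_rpow hqr.le (by linarith) (by linarith)).trans hp)
    have hρ := C.ratio_pos
    have hW := C.meetFraction_nonneg S n q
    calc C.meetFraction S (n + 1) p * C.radius p ^ e
        = C.radius q ^ d * C.meetFraction S n q / C.childMass p * C.radius p ^ e := by
          rw [meetFraction, hsum]
      _ ≤ C.radius q ^ d * C.meetFraction S n q / (C.ratio * C.radius p ^ d) * C.radius p ^ e := by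
          gcongr
          exact C.mass p
      _ = (C.meetFraction S n q * C.radius q ^ e) * C.radius q ^ (d - e)
            / (C.ratio * C.radius p ^ (d - e)) := by
          rw [Real.rpow_sub hqr, Real.rpow_sub hr]
          field_simp
      _ ≤ (C.distortion * s ^ e) * (C.ratio * C.radius p ^ (d - e))
            / (C.ratio * C.radius p ^ (d - e)) := by
          gcongr
      _ = _ := by
          field_simp

lemma exists_rpow_le {a c : ℝ} (ha : 0 < a) (hc : 0 < c) :
    ∃ τ > 0, ∀ r, 0 ≤ r → r ≤ τ → r ^ a ≤ c := by
  refine ⟨c ^ a⁻¹, by positivity, fun r hr h => ?_⟩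
  calc r ^ a ≤ (c ^ a⁻¹) ^ a := by gcongr
    _ = c := Real.rpow_inv_rpow hc.le ha.ne'

/-- Covers of the limit set by finitely many balls have large `e`-dimensional sums. -/
lemma exists_le_sum_of_cover [CompleteSpace X] (p₀ : T) {e : ℝ} (he : 0 ≤ e) (hed : e < d) :
    ∃ c > 0, ∀ (ι : Type) (I : Finset ι) (y : ι → X) (s : ι → ℝ), (∀ i ∈ I, 0 < s i) →
      C.limitSet p₀ ⊆ ⋃ i ∈ I, ball (y i) (s i) → c ≤ ∑ i ∈ I, s i ^ e := by
  obtain ⟨τ, hτ, hτr⟩ := exists_rpow_le (sub_pos.2 hed) C.ratio_pos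
  obtain ⟨N, hN⟩ := C.exists_radius_level_le p₀ hτ
  -- The estimate needs a node small enough to absorb `ratio`, hence a deep `p` instead of the root.
  obtain ⟨p, hp⟩ := C.level_nonempty p₀ N
  have hr := C.radius_pos p
  have hpτ := hτr _ hr.le (hN N le_rfl p hp)
  have hΛ : 0 < C.distortion := zero_lt_one.trans_le (le_max_left _ _)
  refine ⟨C.radius p ^ e / (C.distortion * 2 ^ e), by positivity, fun ι I y s hs hcov => ?_⟩
  have hn : ∃ n : ℕ, ∀ i ∈ I, (1 / 10 : ℝ) ^ n * C.radius p ≤ 2 * s i := by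
    have : ∀ᶠ n : ℕ in atTop, ∀ i ∈ I, (1 / 10 : ℝ) ^ n * C.radius p ≤ 2 * s i := by
      rw [Finset.eventually_all]
      intro i hi
      have ht : Tendsto (fun n : ℕ => (1 / 10 : ℝ) ^ n * C.radius p) atTop (𝓝 (0 * C.radius p)) :=
        (tendsto_pow_atTop_nhds_zero_of_lt_one (by norm_num) (by norm_num)).mul_const _
      rw [zero_mul] at ht
      exact ht.eventually_le_const (by linarith [hs i hi])
    exact this.exists
  obtain ⟨n, hn⟩ := hn
  have h1 := C.meetFraction_le_sum I (fun i => ball (y i) (s i)) hcov n p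
  rw [C.meetFraction_limitSet hp] at h1
  rw [div_le_iff₀ (by positivity)]
  calc C.radius p ^ e = 1 * C.radius p ^ e := (one_mul _).symm
    _ ≤ (∑ i ∈ I, C.meetFraction (ball (y i) (s i)) n p) * C.radius p ^ e := by gcongr
    _ = ∑ i ∈ I, C.meetFraction (ball (y i) (s i)) n p * C.radius p ^ e := Finset.sum_mul _ _ _
    _ ≤ ∑ i ∈ I, C.distortion * (2 * s i) ^ e := by
      refine Finset.sum_le_sum fun i hi => ?_
      refine C.meetFraction_mul_le (by linarith [hs i hi]) he hed (fun a ha b hb => ?_) n p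
        (hn i hi) hpτ
      have h2 : dist a (y i) < s i := ha
      have h3 : dist b (y i) < s i := hb
      linarith [dist_triangle_right a b (y i)]
    _ = (∑ i ∈ I, s i ^ e) * (C.distortion * 2 ^ e) := by
      rw [Finset.sum_mul]
      refine Finset.sum_congr rfl fun i hi => ?_
      rw [Real.mul_rpow (by norm_num) (hs i hi).le]
      ring

end CantorScheme

/-! ### From finite ball covers to positive Hausdorff measure. -/

lemma exists_ball_superset {X : Type*} [MetricSpace X] [Nonempty X] {S : Set X} {e : ℝ}
    (he : 0 < e) (hS : ediam S ≠ ∞) {ε : ℝ≥0} (hε : 0 < ε) :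
    ∃ y : X, ∃ s : ℝ, 0 < s ∧ S ⊆ ball y s ∧ ENNReal.ofReal (s ^ e) ≤ ediam S ^ e + ε := by
  obtain ⟨s, hs, hse⟩ : ∃ s, diam S < s ∧ s ^ e < diam S ^ e + ε := by
    have h1 : ∀ᶠ s in 𝓝[>] diam S, s ^ e < diam S ^ e + ε :=
      ((Real.continuous_rpow_const he.le).continuousAt.eventually_lt_const
        (lt_add_of_pos_right _ (by exact_mod_cast hε))).filter_mono nhdsWithin_le_nhds
    obtain ⟨s, hs, h⟩ := (h1.and self_mem_nhdsWithin).exists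
    exact ⟨s, h, hs⟩
  have hle : ENNReal.ofReal (s ^ e) ≤ ediam S ^ e + ε := by
    calc ENNReal.ofReal (s ^ e) ≤ ENNReal.ofReal (diam S ^ e + ε) :=
          ENNReal.ofReal_le_ofReal hse.le
      _ = ENNReal.ofReal (diam S) ^ e + ε := by
        rw [ENNReal.ofReal_add (Real.rpow_nonneg diam_nonneg e) ε.coe_nonneg,
          ENNReal.ofReal_rpow_of_nonneg diam_nonneg he.le, ENNReal.ofReal_coe_nnreal]
      _ = ediam S ^ e + ε := by rw [diam, ENNReal.ofReal_toReal hS]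
  have hs0 : 0 < s := diam_nonneg.trans_lt hs
  rcases S.eq_empty_or_nonempty with h | ⟨y, hy⟩
  · exact ⟨Classical.arbitrary X, s, hs0, by simp [h], hle⟩
  · refine ⟨y, s, hs0, fun x hx => ?_, hle⟩
    exact (dist_le_diam_of_mem' hS hx hy).trans_lt hs

/-- Only an inequality, since a node may be a child of several parents. -/
lemma sum_biUnion_le_of_nonneg {ι κ : Type*} [DecidableEq κ] (s : Finset ι) (t : ι → Finset κ)
    {f : κ → ℝ} (hf : ∀ k, 0 ≤ f k) : ∑ k ∈ s.biUnion t, f k ≤ ∑ i ∈ s, ∑ k ∈ t i, f k := by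
  classical
  induction s using Finset.induction_on with
  | empty => simp
  | insert i s hi ih =>
    rw [Finset.biUnion_insert, Finset.sum_insert hi]
    have h1 := Finset.sum_union_inter (s₁ := t i) (s₂ := s.biUnion t) (f := f)
    have h2 := Finset.sum_nonneg (s := t i ∩ s.biUnion t) fun k _ => hf k
    linarith

/-- A null set has a countable cover of cost below `c / 2`. Enlarging its members to open balls
costs less than another `c / 2`, and compactness leaves finitely many balls of total cost below `c`.
-/
lemma hausdorffMeasure_ne_zero_of_finite_cover {X : Type*} [MetricSpace X] [Nonempty X]
    [MeasurableSpace X] [BorelSpace X] {K : Set X} (hK : IsCompact K) {e c : ℝ} (he : 0 < e) (hc : 0 < c)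
    (h : ∀ (I : Finset ℕ) (y : ℕ → X) (s : ℕ → ℝ), (∀ i ∈ I, 0 < s i) →
      K ⊆ ⋃ i ∈ I, ball (y i) (s i) → c ≤ ∑ i ∈ I, s i ^ e) : μH[e] K ≠ 0 := by
  intro h0
  have hη : ENNReal.ofReal (c / 2) ≠ 0 := by simpa using hc
  rw [Measure.hausdorffMeasure_apply] at h0
  have h1 := (le_iSup₂ (f := fun (r : ℝ≥0∞) (_ : 0 < r) => ⨅ (t : ℕ → Set X) (_ : K ⊆ ⋃ n, t n)
    (_ : ∀ n, ediam (t n) ≤ r), ∑' n, ⨆ _ : (t n).Nonempty, ediam (t n) ^ e) 1 one_pos).trans h0.le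
  have h2 := h1.trans_lt (pos_iff_ne_zero.2 hη)
  simp only [iInf_lt_iff] at h2
  obtain ⟨t, htK, ht1, ht⟩ := h2
  obtain ⟨ε, hε, hεsum⟩ := ENNReal.exists_pos_sum_of_countable hη ℕ
  choose y s hs hsub hse using fun n => exists_ball_superset he
    ((ht1 n).trans_lt ENNReal.one_lt_top).ne (hε n)
  obtain ⟨I, hI⟩ := hK.elim_finite_subcover (fun n => ball (y n) (s n)) (fun n => isOpen_ball)
    (htK.trans (Set.iUnion_mono hsub))
  have hcI := h I y s (fun i _ => hs i) hI
  have hlt : ENNReal.ofReal (∑ i ∈ I, s i ^ e) < ENNReal.ofReal c := by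
    rw [ENNReal.ofReal_sum_of_nonneg fun i _ => Real.rpow_nonneg (hs i).le e]
    calc ∑ i ∈ I, ENNReal.ofReal (s i ^ e)
        ≤ ∑ i ∈ I, ((⨆ _ : (t i).Nonempty, ediam (t i) ^ e) + ε i) := by
          refine Finset.sum_le_sum fun i _ => (hse i).trans ?_
          gcongr
          rcases (t i).eq_empty_or_nonempty with h | h
          · simp [h, he]
          · simp [h]
      _ = ∑ i ∈ I, (⨆ _ : (t i).Nonempty, ediam (t i) ^ e) + ∑ i ∈ I, (ε i : ℝ≥0∞) :=
          Finset.sum_add_distrib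
      _ ≤ ∑' i, (⨆ _ : (t i).Nonempty, ediam (t i) ^ e) + ∑' i, (ε i : ℝ≥0∞) :=
          add_le_add (ENNReal.sum_le_tsum _) (ENNReal.sum_le_tsum _)
      _ < ENNReal.ofReal (c / 2) + ENNReal.ofReal (c / 2) := ENNReal.add_lt_add ht hεsum
      _ = ENNReal.ofReal c := by
        rw [← ENNReal.ofReal_add (by positivity) (by positivity), add_halves]
  exact absurd (ENNReal.ofReal_le_ofReal hcI) (not_le.2 hlt)

/-! ### The dimension of the limit set. -/

namespace CantorScheme

variable {X : Type*} [MetricSpace X] {d : ℝ} {T : Type*} (C : CantorScheme X d T)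

lemma le_dimH_limitSet [CompleteSpace X] (p₀ : T) {e : ℝ≥0} (he : 0 < e) (hed : (e : ℝ) < d) :
    (e : ℝ≥0∞) ≤ dimH (C.limitSet p₀) := by
  borelize X
  have : Nonempty X := ⟨C.center p₀⟩
  obtain ⟨c, hc, h⟩ := C.exists_le_sum_of_cover p₀ e.2 hed
  exact le_dimH_of_hausdorffMeasure_ne_zero
    (hausdorffMeasure_ne_zero_of_finite_cover (C.isCompact_limitSet p₀) he hc (h ℕ))

/-- Since `radius q ≤ radius p ^ 2`, a spare factor `radius p ^ (e - d)` remains to cancel the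
packing constant `2 * 2 ^ d`. -/
lemma sum_children_rpow_le {e : ℝ} (hde : d < e) {p : T}
    (hp : C.radius p ^ (e - d) ≤ (2 * 2 ^ d)⁻¹) :
    ∑ q ∈ C.children p, C.radius q ^ e ≤ C.radius p ^ e := by
  have hr := C.radius_pos p
  calc ∑ q ∈ C.children p, C.radius q ^ e
      ≤ ∑ q ∈ C.children p, C.radius q ^ d * (C.radius p ^ 2) ^ (e - d) := by
        refine Finset.sum_le_sum fun q hq => ?_
        have hqr := C.radius_pos q
        calc C.radius q ^ e = C.radius q ^ d * C.radius q ^ (e - d) := by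
              rw [← Real.rpow_add hqr]; congr 1; ring
          _ ≤ _ := by
            gcongr
            exact C.radius_child p q hq
    _ = C.childMass p * (C.radius p ^ 2) ^ (e - d) := (Finset.sum_mul _ _ _).symm
    _ ≤ 2 * (2 * C.radius p) ^ d * (C.radius p ^ 2) ^ (e - d) := by
        gcongr
        exact C.childMass_le
    _ = (2 * 2 ^ d * C.radius p ^ (e - d)) * C.radius p ^ e := by
        rw [Real.mul_rpow (by norm_num) hr.le, sq, Real.mul_rpow hr.le hr.le]
        rw [show C.radius p ^ e = C.radius p ^ d * C.radius p ^ (e - d) by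
          rw [← Real.rpow_add hr]; congr 1; ring]
        ring
    _ ≤ 1 * C.radius p ^ e := by
        gcongr
        rw [mul_comm]
        exact (le_mul_inv_iff₀ (by positivity)).1 (by rwa [one_mul])
    _ = _ := one_mul _

lemma dimH_limitSet_le (hd : 0 < d) (p₀ : T) {e : ℝ≥0} (hde : d < e) :
    dimH (C.limitSet p₀) ≤ e := by
  classical
  borelize X
  have he : (0 : ℝ) < e := hd.trans hde
  obtain ⟨τ, hτ, hτr⟩ := exists_rpow_le (sub_pos.2 hde) (c := (2 * 2 ^ d)⁻¹) (by positivity)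
  obtain ⟨N, hN⟩ := C.exists_radius_level_le p₀ hτ
  set a : ℕ → ℝ := fun n => ∑ p ∈ C.level p₀ n, C.radius p ^ (e : ℝ) with ha
  have hstep : ∀ n ≥ N, a (n + 1) ≤ a n := by
    intro n hn
    have hlev : C.level p₀ (n + 1) = (C.level p₀ n).biUnion C.children := by
      ext q; simp [C.mem_level_succ]
    calc a (n + 1) ≤ ∑ p ∈ C.level p₀ n, ∑ q ∈ C.children p, C.radius q ^ (e : ℝ) := by
          rw [ha]
          simp only [hlev]
          exact sum_biUnion_le_of_nonneg _ _ fun q => Real.rpow_nonneg (C.radius_pos q).le _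
      _ ≤ a n := Finset.sum_le_sum fun p hp =>
          C.sum_children_rpow_le hde (hτr _ (C.radius_pos p).le (hN n hn p hp))
  have hbound : ∀ n ≥ N, a n ≤ a N := by
    intro n hn
    induction n, hn using Nat.le_induction with
    | base => exact le_rfl
    | succ n hn ih => exact (hstep n hn).trans ih
  have hdiam : ∀ p, ediam (C.cell p) ≤ ENNReal.ofReal (4 * C.radius p) := fun p => by
    refine ediam_le fun x hx y hy => ?_
    rw [edist_dist]
    refine ENNReal.ofReal_le_ofReal ?_
    have hx' : dist x (C.center p) ≤ 2 * C.radius p := hx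
    have hy' : dist y (C.center p) ≤ 2 * C.radius p := hy
    linarith [dist_triangle_right x y (C.center p)]
  refine dimH_le_of_hausdorffMeasure_ne_top (ne_top_of_le_ne_top ?_
    (Measure.hausdorffMeasure_le_liminf_sum (ι := fun n => C.level p₀ n) e (C.limitSet p₀)
      (l := atTop) (fun n : ℕ => ENNReal.ofReal (4 * (1 / 10) ^ n)) ?_
      (fun n p => C.cell p) (Eventually.of_forall fun n p => ?_)
      (Eventually.of_forall fun n x hx => ?_)))
  · refine ne_top_of_le_ne_top (b := ENNReal.ofReal (4 ^ (e : ℝ) * a N)) ENNReal.ofReal_ne_top ?_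
    refine liminf_le_of_frequently_le' (Eventually.frequently ?_)
    filter_upwards [eventually_ge_atTop N] with n hn
    rw [Finset.sum_coe_sort (C.level p₀ n) (fun p => ediam (C.cell p) ^ (e : ℝ))]
    calc ∑ p ∈ C.level p₀ n, ediam (C.cell p) ^ (e : ℝ)
        ≤ ∑ p ∈ C.level p₀ n, ENNReal.ofReal (4 ^ (e : ℝ) * C.radius p ^ (e : ℝ)) := by
          refine Finset.sum_le_sum fun p _ => ?_
          have hr := (C.radius_pos p).le
          rw [← Real.mul_rpow (by norm_num) hr,
            ← ENNReal.ofReal_rpow_of_nonneg (by positivity) he.le]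
          exact ENNReal.rpow_le_rpow (hdiam p) he.le
      _ = ENNReal.ofReal (4 ^ (e : ℝ) * a n) := by
          rw [ha, Finset.mul_sum, ENNReal.ofReal_sum_of_nonneg]
          intro p _
          have hr := (C.radius_pos p).le
          positivity
      _ ≤ _ := ENNReal.ofReal_le_ofReal (by have := hbound n hn; gcongr)
  · have ht : Tendsto (fun n : ℕ => 4 * (1 / 10 : ℝ) ^ n) atTop (𝓝 (4 * 0)) :=
      (tendsto_pow_atTop_nhds_zero_of_lt_one (by norm_num) (by norm_num)).const_mul _
    simpa using ENNReal.tendsto_ofReal ht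
  · exact (hdiam p).trans (ENNReal.ofReal_le_ofReal (by
      have := C.radius_level_le p.2
      linarith))
  · obtain ⟨p, hp, hx⟩ := Set.mem_iUnion₂.1 (Set.mem_iInter.1 hx n)
    exact Set.mem_iUnion.2 ⟨⟨p, hp⟩, hx⟩

theorem dimH_limitSet [CompleteSpace X] {d : ℝ≥0} (C : CantorScheme X d T) (hd : 0 < d) (p₀ : T) :
    dimH (C.limitSet p₀) = d := by
  refine le_antisymm ?_ ?_
  · refine ENNReal.le_of_forall_pos_le_add fun ε hε _ => ?_
    have := C.dimH_limitSet_le hd p₀ (e := d + ε) (by exact_mod_cast lt_add_of_pos_right d hε)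
    exact_mod_cast this
  · refine le_of_forall_lt fun b hb => ?_
    obtain ⟨e, hbe, hed⟩ := ENNReal.lt_iff_exists_nnreal_btwn.1 hb
    exact hbe.trans_le (C.le_dimH_limitSet p₀ (by
      by_contra h
      simp [nonpos_iff_eq_zero.1 (not_lt.1 h)] at hbe) (by exact_mod_cast hed))

end CantorScheme

/-! ### Hausdorff content and thick points. -/

section Content

variable {X : Type*} [MetricSpace X] {d : ℝ}

/-- The `d`-dimensional Hausdorff content. -/
noncomputable def hausdorffContent (X : Type*) [MetricSpace X] (d : ℝ) : OuterMeasure X :=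
  OuterMeasure.boundedBy fun s => ediam s ^ d

lemma hausdorffContent_le (S : Set X) : hausdorffContent X d S ≤ ediam S ^ d :=
  OuterMeasure.boundedBy_le S

lemma hausdorffContent_closedBall_le (hd : 0 < d) (x : X) {r : ℝ} (hr : 0 ≤ r) :
    hausdorffContent X d (closedBall x r) ≤ ENNReal.ofReal ((2 * r) ^ d) := by
  refine (hausdorffContent_le _).trans ?_
  rw [← ENNReal.ofReal_rpow_of_nonneg (by positivity) hd.le]
  refine ENNReal.rpow_le_rpow (ediam_le fun a ha b hb => ?_) hd.le
  rw [edist_dist]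
  refine ENNReal.ofReal_le_ofReal ?_
  have ha' : dist a x ≤ r := ha
  have hb' : dist b x ≤ r := hb
  linarith [dist_triangle_right a b x]

lemma exists_cover_of_hausdorffContent_lt {S : Set X} {a : ℝ≥0∞} (h : hausdorffContent X d S < a) :
    ∃ t : ℕ → Set X, S ⊆ ⋃ n, t n ∧ ∑' n, ⨆ _ : (t n).Nonempty, ediam (t n) ^ d < a := by
  rw [hausdorffContent, OuterMeasure.boundedBy_apply] at h
  simpa only [iInf_lt_iff, exists_prop] using h

/-- A cover of total cost below `r ^ d` automatically consists of sets of diameter at most `r`. -/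
lemma hausdorffMeasure_eq_zero_of_content [MeasurableSpace X] [BorelSpace X] (hd : 0 < d)
    {S : Set X} (h : hausdorffContent X d S = 0) : μH[d] S = 0 := by
  rw [Measure.hausdorffMeasure_apply, ← nonpos_iff_eq_zero]
  refine iSup₂_le fun r hr => le_of_forall_gt fun η hη => ?_
  have hpos : 0 < min η (r ^ d) := lt_min hη (ENNReal.rpow_pos_of_nonneg hr hd.le)
  obtain ⟨t, htS, ht⟩ := exists_cover_of_hausdorffContent_lt (h.trans_lt hpos)
  have htr : ∀ n, ediam (t n) ≤ r := by
    intro n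
    rcases (t n).eq_empty_or_nonempty with hn | hn
    · simp [hn]
    · rw [← ENNReal.rpow_le_rpow_iff hd]
      calc ediam (t n) ^ d = ⨆ _ : (t n).Nonempty, ediam (t n) ^ d := by simp [hn]
        _ ≤ _ := ENNReal.le_tsum n
        _ ≤ r ^ d := ht.le.trans (min_le_right _ _)
  exact (iInf₂_le_of_le t htS (iInf_le_of_le htr le_rfl)).trans_lt
    (ht.trans_le (min_le_left _ _))

/-- The points around which all balls of radius at most `ρ` have small content. -/
def thinPoints (X : Type*) [MetricSpace X] (d ρ : ℝ) : Set X :=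
  {x | ∀ r, 0 < r → r ≤ ρ → hausdorffContent X d (closedBall x r) < ENNReal.ofReal (r ^ d / 2)}

/-- `S` lies in the ball of radius `diam S` about any of its points, and thinness halves the content
of that ball. -/
lemma two_mul_content_le_of_subset_thinPoints (hd : 0 < d) {ρ : ℝ} {S : Set X}
    (hS : S ⊆ thinPoints X d ρ) (hSρ : ediam S ≤ ENNReal.ofReal ρ) :
    2 * hausdorffContent X d S ≤ ediam S ^ d := by
  have hfin : ediam S ≠ ∞ := ne_top_of_le_ne_top ENNReal.ofReal_ne_top hSρ
  by_cases h0 : ediam S = 0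
  · have := hausdorffContent_le (d := d) S
    rw [h0, ENNReal.zero_rpow_of_pos hd] at this
    simp [nonpos_iff_eq_zero.1 this]
  · obtain ⟨x, hx⟩ : S.Nonempty := by
      by_contra h
      simp [Set.not_nonempty_iff_eq_empty.1 h] at h0
    have hpos : 0 < diam S := ENNReal.toReal_pos h0 hfin
    have hle : diam S ≤ ρ := by
      rcases le_total 0 ρ with hρ | hρ
      · exact ENNReal.toReal_le_of_le_ofReal hρ hSρ
      · rw [ENNReal.ofReal_of_nonpos hρ] at hSρ
        exact (h0 (nonpos_iff_eq_zero.1 hSρ)).elim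
    have hsub : S ⊆ closedBall x (diam S) := fun y hy => dist_le_diam_of_mem' hfin hy hx
    calc 2 * hausdorffContent X d S
        ≤ 2 * hausdorffContent X d (closedBall x (diam S)) := by gcongr
      _ ≤ 2 * ENNReal.ofReal (diam S ^ d / 2) := by
        gcongr
        exact (hS hx _ hpos hle).le
      _ = ENNReal.ofReal (diam S ^ d) := by
        rw [show (2 : ℝ≥0∞) = ENNReal.ofReal 2 by simp, ← ENNReal.ofReal_mul (by norm_num)]
        congr 1; ring
      _ = ediam S ^ d := by
        rw [← ENNReal.ofReal_rpow_of_nonneg hpos.le hd.le, diam, ENNReal.ofReal_toReal hfin]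

/-- Halving the cost of each piece `S ∩ t n` of a near-optimal cover shows that twice the content is
at most the content, which is finite. -/
lemma content_eq_zero_of_subset_thinPoints (hd : 0 < d) {ρ : ℝ} {S : Set X}
    (hS : S ⊆ thinPoints X d ρ) (hSρ : ediam S ≤ ENNReal.ofReal ρ) :
    hausdorffContent X d S = 0 := by
  have hfin : hausdorffContent X d S ≠ ∞ := ne_top_of_le_ne_top
    (ENNReal.rpow_ne_top_of_nonneg hd.le (ne_top_of_le_ne_top ENNReal.ofReal_ne_top hSρ))
    (hausdorffContent_le S)
  have h2 : 2 * hausdorffContent X d S ≤ hausdorffContent X d S := by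
    refine le_of_forall_gt fun a ha => ?_
    obtain ⟨t, htS, ht⟩ := exists_cover_of_hausdorffContent_lt ha
    refine lt_of_le_of_lt ?_ ht
    calc 2 * hausdorffContent X d S ≤ 2 * ∑' n, hausdorffContent X d (S ∩ t n) := by
          gcongr
          refine le_trans (measure_mono fun x hx => ?_) (measure_iUnion_le _)
          obtain ⟨n, hn⟩ := Set.mem_iUnion.1 (htS hx)
          exact Set.mem_iUnion.2 ⟨n, hx, hn⟩
      _ = ∑' n, 2 * hausdorffContent X d (S ∩ t n) := ENNReal.tsum_mul_left.symm
      _ ≤ ∑' n, ⨆ _ : (t n).Nonempty, ediam (t n) ^ d := by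
          refine ENNReal.tsum_le_tsum fun n => ?_
          rcases (t n).eq_empty_or_nonempty with hn | hn
          · simp [hn]
          · simp only [hn, iSup_pos]
            exact (two_mul_content_le_of_subset_thinPoints hd (Set.inter_subset_left.trans hS)
              ((ediam_mono Set.inter_subset_left).trans hSρ)).trans
              (ENNReal.rpow_le_rpow (ediam_mono Set.inter_subset_right) hd.le)
  rw [two_mul] at h2
  by_contra hne
  exact (ENNReal.lt_add_right hfin hne).not_ge h2

lemma content_thinPoints [TopologicalSpace.SeparableSpace X] (hd : 0 < d) {ρ : ℝ} (hρ : 0 < ρ) :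
    hausdorffContent X d (thinPoints X d ρ) = 0 := by
  obtain ⟨s, hs, hsd⟩ := TopologicalSpace.exists_countable_dense X
  have hsub : thinPoints X d ρ ⊆ ⋃ y ∈ s, thinPoints X d ρ ∩ closedBall y (ρ / 2) := by
    intro x hx
    obtain ⟨y, hy, hxy⟩ := hsd.exists_dist_lt x (half_pos hρ)
    exact Set.mem_iUnion₂.2 ⟨y, hy, hx, hxy.le⟩
  refine measure_mono_null hsub ((measure_biUnion_null_iff hs).2 fun y _ => ?_)
  refine content_eq_zero_of_subset_thinPoints hd Set.inter_subset_left ?_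
  refine (ediam_mono Set.inter_subset_right).trans (ediam_le fun a ha b hb => ?_)
  rw [edist_dist]
  refine ENNReal.ofReal_le_ofReal ?_
  have ha' : dist a y ≤ ρ / 2 := ha
  have hb' : dist b y ≤ ρ / 2 := hb
  linarith [dist_triangle_right a b y]

/-- The points with arbitrarily small balls of large content. -/
def thickPoints (X : Type*) [MetricSpace X] (d : ℝ) : Set X :=
  (⋃ n : ℕ, thinPoints X d (1 / (n + 1)))ᶜ

lemma content_compl_thickPoints [TopologicalSpace.SeparableSpace X] (hd : 0 < d) :
    hausdorffContent X d (thickPoints X d)ᶜ = 0 := by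
  rw [thickPoints, compl_compl]
  exact measure_iUnion_null fun n => content_thinPoints hd (by positivity)

/-- Restricting to thick points loses no content, so the construction can choose its next centres
among them. -/
lemma exists_content_ge [TopologicalSpace.SeparableSpace X] (hd : 0 < d) {x : X}
    (hx : x ∈ thickPoints X d) {ρ : ℝ} (hρ : 0 < ρ) : ∃ r, 0 < r ∧ r ≤ ρ ∧
      ENNReal.ofReal (r ^ d / 2) ≤ hausdorffContent X d (thickPoints X d ∩ closedBall x r) := by
  obtain ⟨n, hn⟩ := exists_nat_one_div_lt hρ
  have hxn : x ∉ thinPoints X d (1 / (n + 1)) := fun h => hx (Set.mem_iUnion.2 ⟨n, h⟩)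
  simp only [thinPoints, Set.mem_ofPred_eq, not_forall, not_lt] at hxn
  obtain ⟨r, hr, hrn, h⟩ := hxn
  refine ⟨r, hr, hrn.trans hn.le, h.trans ?_⟩
  calc hausdorffContent X d (closedBall x r)
      ≤ hausdorffContent X d ((thickPoints X d ∩ closedBall x r) ∪ (thickPoints X d)ᶜ) :=
        measure_mono fun y hy => by
          by_cases h : y ∈ thickPoints X d
          · exact Or.inl ⟨h, hy⟩
          · exact Or.inr h
    _ ≤ _ := measure_union_le _ _
    _ = _ := by rw [content_compl_thickPoints hd, add_zero]

end Content

/-! ### Maximal packed families and the covering argument. -/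

section Packing

variable {X : Type*} [MetricSpace X] {ι : Type*} {d : ℝ}

/-- A finite family of balls is packed up to scale `R` if the `d`-dimensional mass of the balls
centred in a concentric ball of radius `s` is at most `2 * s ^ d`. -/
def IsPacked (x : ι → X) (r : ι → ℝ) (d R : ℝ) (T : Finset ι) : Prop :=
  ∀ i ∈ T, ∀ s, r i ≤ s → s ≤ R → ∑ j ∈ T.filter (fun j => dist (x j) (x i) ≤ s), r j ^ d ≤ 2 * s ^ d

/-- The condition concerns finite subfamilies only, so it passes to unions of chains and Zorn's
lemma applies. -/
lemma exists_maximal_packed (x : ι → X) (r : ι → ℝ) (d R : ℝ) (D : Set ι) :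
    ∃ F, Maximal (fun F : Set ι => F ⊆ D ∧ ∀ T : Finset ι, ↑T ⊆ F → IsPacked x r d R T) F := by
  refine zorn_subset {F : Set ι | F ⊆ D ∧ ∀ T : Finset ι, ↑T ⊆ F → IsPacked x r d R T}
    fun c hc hchain => ?_
  refine ⟨⋃₀ c, ⟨Set.sUnion_subset fun F hF => (hc hF).1, fun T hT => ?_⟩,
    fun F hF => Set.subset_sUnion_of_mem hF⟩
  rcases c.eq_empty_or_nonempty with rfl | hne
  · intro i hi
    simpa using hT hi
  · obtain ⟨F, hF, hTF⟩ := DirectedOn.exists_mem_subset_of_finset_subset_biUnion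
      (f := id) hne hchain.directedOn (s := T) (by simpa [Set.sUnion_eq_biUnion] using hT)
    exact (hc hF).2 T hTF

/-- Every ball of a separated family meets a ball saturated by a maximal packed subfamily. -/
lemma exists_saturated {x : ι → X} {r : ι → ℝ} {R : ℝ} {D F : Set ι} (hd : 0 < d)
    (hr : ∀ i ∈ D, 0 < r i) (hR : ∀ i ∈ D, r i ≤ R)
    (hsep : ∀ i ∈ D, ∀ j ∈ D, i ≠ j → 5 * r i < dist (x i) (x j))
    (hF : Maximal (fun F : Set ι => F ⊆ D ∧ ∀ T : Finset ι, ↑T ⊆ F → IsPacked x r d R T) F)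
    {i : ι} (hi : i ∈ D) :
    ∃ (y : X) (s : ℝ) (T : Finset ι), ↑T ⊆ F ∧ r i ≤ s ∧ s ≤ R ∧ dist (x i) y ≤ s ∧
      (∀ j ∈ T, dist (x j) y ≤ s) ∧ s ^ d ≤ ∑ j ∈ T, r j ^ d := by
  classical
  have hri := hr i hi
  by_cases hiF : i ∈ F
  · exact ⟨x i, r i, {i}, by simpa using hiF, le_rfl, hR i hi, by simpa using hri.le,
      by simpa using hri.le, by simp⟩
  -- By maximality, adding `i` violates packing in some ball of radius `s` about some `x k`. Its
  -- mass exceeds `2 * s ^ d`, of which `i` accounts for at most `s ^ d`; the rest comes from `F`.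
  have hnot : ¬ ∀ T : Finset ι, ↑T ⊆ insert i F → IsPacked x r d R T := fun h =>
    hiF (hF.2 ⟨Set.insert_subset hi hF.1.1, h⟩ (Set.subset_insert i F) (Set.mem_insert i F))
  simp only [IsPacked, not_forall, not_le] at hnot
  obtain ⟨T, hT, k, hk, s, hks, hsR, hlt⟩ := hnot
  have hTD : ∀ j ∈ T, j ∈ D := fun j hj =>
    (hT hj).elim (fun h => h ▸ hi) (fun h => hF.1.1 h)
  have hrk := hr k (hTD k hk)
  have hTe : ↑(T.erase i) ⊆ F := fun j hj => by
    obtain ⟨hne, hj⟩ := Finset.mem_erase.1 (Finset.mem_coe.1 hj)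
    exact (hT hj).resolve_left hne
  have him : i ∈ T.filter (fun j => dist (x j) (x k) ≤ s) := by
    by_contra him
    have hki : k ≠ i := by
      rintro rfl
      exact him (Finset.mem_filter.2 ⟨hk, by simpa using hrk.le.trans hks⟩)
    have := hF.1.2 _ hTe k (Finset.mem_erase.2 ⟨hki, hk⟩) s hks hsR
    rw [Finset.filter_erase, Finset.erase_eq_of_notMem him] at this
    linarith
  obtain ⟨hiT, hik⟩ := Finset.mem_filter.1 him
  have his : r i ≤ s := by
    by_cases hki : i = k
    · exact hki ▸ hks
    · linarith [hsep i hi k (hTD k hk) hki]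
  refine ⟨x k, s, (T.filter (fun j => dist (x j) (x k) ≤ s)).erase i, ?_, his, hsR, hik, ?_, ?_⟩
  · exact (Finset.coe_subset.2 (Finset.erase_subset_erase i (Finset.filter_subset _ _))).trans hTe
  · intro j hj
    exact (Finset.mem_filter.1 (Finset.mem_of_mem_erase hj)).2
  · have h1 := Finset.add_sum_erase _ (fun j => r j ^ d) him
    have h2 := Real.rpow_le_rpow hri.le his hd.le
    linarith

/-- If all separated packed finite families of balls centred at points of `B` have mass at most
`M`, then the content of `B` is bounded by a multiple of `M`. -/
lemma content_le_of_forall_packed [TopologicalSpace.SeparableSpace X] {x : ι → X} {r : ι → ℝ}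
    {R M : ℝ} {B : Set X} {t : Set ι} (hd : 0 < d) (hr : ∀ i ∈ t, 0 < r i) (hR : ∀ i ∈ t, r i ≤ R)
    (hB : ∀ y ∈ B, ∃ i ∈ t, x i = y)
    (hM : ∀ T : Finset ι, ↑T ⊆ t → (∀ i ∈ T, ∀ j ∈ T, i ≠ j → 5 * r i < dist (x i) (x j)) →
      IsPacked x r d R T → ∑ i ∈ T, r i ^ d ≤ M) :
    hausdorffContent X d B ≤ ENNReal.ofReal (260 ^ d * M) := by
  classical
  rcases B.eq_empty_or_nonempty with rfl | ⟨z₀, -⟩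
  · simp
  have : Nonempty X := ⟨z₀⟩
  -- Disjointness of the balls of radius `5 * r i` yields the separation condition.
  obtain ⟨D, hDt, hDdisj, hDcov⟩ := Vitali.exists_disjoint_subfamily_covering_enlargement_closedBall
    t x (fun i => 5 * r i) (5 * R) (fun i hi => by linarith [hR i hi]) 5 (by norm_num)
  have hrD : ∀ i ∈ D, 0 < r i := fun i hi => hr i (hDt hi)
  have hsep : ∀ i ∈ D, ∀ j ∈ D, i ≠ j → 5 * r i < dist (x i) (x j) := by
    intro i hi j hj hij
    by_contra h
    have h1 : x j ∈ closedBall (x i) (5 * r i) := by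
      rw [mem_closedBall, dist_comm]; exact not_lt.1 h
    exact Set.disjoint_left.1 (hDdisj hi hj hij) h1
      (mem_closedBall_self (by linarith [hrD j hj]))
  obtain ⟨F, hF⟩ := exists_maximal_packed x r d R D
  choose! y s T hTF hrs hsR hxy hTy hsum using fun i (hi : i ∈ D) =>
    exists_saturated hd hrD (fun i hi => hR i (hDt hi)) hsep hF hi
  -- A point within `25 * r b` of `x b` is within `26 * s b` of `y b`. Disjointness at this scale
  -- also makes the saturating families `T c` disjoint, so their masses add up to at most `M`.
  -- Enlarging by `5` and passing to diameters gives `260 = 2 * 5 * 26`.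
  obtain ⟨u, huD, hudisj, hucov⟩ := Vitali.exists_disjoint_subfamily_covering_enlargement_closedBall
    D y (fun i => 26 * s i) (26 * R) (fun i hi => by linarith [hsR i hi]) 5 (by norm_num)
  have hs : ∀ i ∈ D, 0 < s i := fun i hi => (hrD i hi).trans_le (hrs i hi)
  have hcount : u.Countable := by
    refine hudisj.countable_of_nonempty_interior fun i hi => ⟨y i, ?_⟩
    exact ball_subset_interior_closedBall (mem_ball_self (by linarith [hs i (huD hi)]))
  have hBu : B ⊆ ⋃ c ∈ u, closedBall (y c) (130 * s c) := by
    intro z hz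
    obtain ⟨a, ha, rfl⟩ := hB z hz
    obtain ⟨b, hb, hab⟩ := hDcov a ha
    obtain ⟨c, hc, hbc⟩ := hucov b hb
    refine Set.mem_iUnion₂.2 ⟨c, hc, ?_⟩
    have h1 : x a ∈ closedBall (x b) (5 * (5 * r b)) :=
      hab (mem_closedBall_self (by linarith [hr a ha]))
    have h2 : x a ∈ closedBall (y b) (26 * s b) := by
      rw [mem_closedBall] at h1 ⊢
      linarith [dist_triangle (x a) (x b) (y b), hxy b hb, hrs b hb]
    have := hbc h2
    rwa [← mul_assoc, show (5 : ℝ) * 26 = 130 by norm_num] at this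
  have : Countable u := hcount.to_subtype
  calc hausdorffContent X d B
      ≤ ∑' c : u, hausdorffContent X d (closedBall (y c) (130 * s c)) :=
        (measure_mono hBu).trans (measure_biUnion_le _ hcount _)
    _ ≤ ∑' c : u, ENNReal.ofReal (260 ^ d * s c ^ d) := by
        refine ENNReal.tsum_le_tsum fun c => ?_
        have hsc := (hs c (huD c.2)).le
        refine (hausdorffContent_closedBall_le hd _ (by linarith)).trans (le_of_eq ?_)
        rw [← Real.mul_rpow (by norm_num) hsc, ← mul_assoc]
        norm_num
    _ ≤ ENNReal.ofReal (260 ^ d * M) := by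
        refine ENNReal.summable.tsum_le_of_sum_le fun I => ?_
        rw [← ENNReal.ofReal_sum_of_nonneg fun c _ => by
          have hsc := (hs c (huD c.2)).le
          positivity]
        refine ENNReal.ofReal_le_ofReal ?_
        rw [← Finset.mul_sum]
        gcongr
        have hdisj : Set.PairwiseDisjoint (I : Set u) (fun c : u => T c) := by
          intro c _ c' _ hne
          refine Finset.disjoint_left.2 fun j hj hj' => ?_
          have hmem : ∀ c : u, j ∈ T c → x j ∈ closedBall (y c) (26 * s c) := fun c hj => by
            rw [mem_closedBall]
            linarith [hTy c (huD c.2) j hj, hs c (huD c.2)]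
          exact Set.disjoint_left.1 (hudisj c.2 c'.2 (fun h => hne (Subtype.ext h)))
            (hmem c hj) (hmem c' hj')
        have hsubF : ↑(I.biUnion fun c : u => T c) ⊆ F := by
          intro j hj
          obtain ⟨c, _, hj⟩ := Finset.mem_biUnion.1 (Finset.mem_coe.1 hj)
          exact hTF c (huD c.2) hj
        have hsubD := hsubF.trans hF.1.1
        calc ∑ c ∈ I, s c ^ d ≤ ∑ c ∈ I, ∑ j ∈ T c, r j ^ d :=
              Finset.sum_le_sum fun c _ => hsum c (huD c.2)
          _ = ∑ j ∈ I.biUnion fun c : u => T c, r j ^ d := (Finset.sum_biUnion hdisj).symm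
          _ ≤ M := hM _ (hsubD.trans hDt)
              (fun i hi j hj => hsep i (hsubD hi) j (hsubD hj)) (hF.1.2 _ hsubF)

end Packing

/-! ### The scheme of thick balls and the conclusion. -/

section Construction

variable {X : Type*} [MetricSpace X] {d : ℝ}

/-- Small balls centred at thick points in which the thick points have large content. -/
def ThickBall (X : Type*) [MetricSpace X] (d : ℝ) : Type _ :=
  {p : X × ℝ // p.1 ∈ thickPoints X d ∧ 0 < p.2 ∧ p.2 ≤ 1 / 10 ∧
    ENNReal.ofReal (p.2 ^ d / 2) ≤ hausdorffContent X d (thickPoints X d ∩ closedBall p.1 p.2)}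

/-- If every admissible family had smaller mass, `content_le_of_forall_packed` would bound the
content of the thick points in the ball by `r ^ d / 4`, against the lower bound `r ^ d / 2`. -/
lemma ThickBall.exists_children [TopologicalSpace.SeparableSpace X] (hd : 0 < d)
    (p : ThickBall X d) : ∃ T : Finset (ThickBall X d),
      (∀ q ∈ T, q.1.2 ≤ p.1.2 ^ 2 ∧ dist q.1.1 p.1.1 ≤ p.1.2) ∧
      (∀ q ∈ T, ∀ q' ∈ T, q ≠ q' → 5 * q.1.2 < dist q.1.1 q'.1.1) ∧
      IsPacked (fun q : ThickBall X d => q.1.1) (fun q => q.1.2) d (5 * p.1.2) T ∧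
      (4 * 260 ^ d)⁻¹ * p.1.2 ^ d ≤ ∑ q ∈ T, q.1.2 ^ d := by
  obtain ⟨⟨x, r⟩, hx, hr, hr10, hc⟩ := p
  dsimp only at hx hr hr10 hc ⊢
  by_contra hcon
  push Not at hcon
  have h := content_le_of_forall_packed (x := fun q : ThickBall X d => q.1.1)
    (r := fun q => q.1.2) (R := 5 * r) (M := (4 * 260 ^ d)⁻¹ * r ^ d)
    (B := thickPoints X d ∩ closedBall x r)
    (t := {q | q.1.2 ≤ r ^ 2 ∧ dist q.1.1 x ≤ r}) hd (fun q _ => q.2.2.1)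
    (fun q hq => by nlinarith [hq.1]) (fun y hy => ?_)
    (fun T hT hsep hpack => (hcon T (fun q hq => hT hq) hsep hpack).le)
  · have h1 := hc.trans h
    rw [ENNReal.ofReal_le_ofReal_iff (by positivity)] at h1
    have h2 : (260 : ℝ) ^ d * ((4 * 260 ^ d)⁻¹ * r ^ d) = r ^ d / 4 := by
      field_simp
    have := Real.rpow_pos_of_pos hr d
    linarith
  · obtain ⟨s, hs, hsr, h⟩ := exists_content_ge hd hy.1 (ρ := r ^ 2) (by positivity)
    exact ⟨⟨(y, s), hy.1, hs, by nlinarith, h⟩, ⟨hsr, hy.2⟩, rfl⟩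

lemma nonempty_thickBall [TopologicalSpace.SeparableSpace X] (hd : 0 < d)
    (h : hausdorffContent X d Set.univ ≠ 0) : Nonempty (ThickBall X d) := by
  obtain ⟨x, hx⟩ : (thickPoints X d).Nonempty := by
    by_contra hne
    have := content_compl_thickPoints (X := X) hd
    rw [Set.not_nonempty_iff_eq_empty.1 hne, Set.compl_empty] at this
    exact h this
  obtain ⟨r, hr, hr10, hc⟩ := exists_content_ge hd hx (ρ := 1 / 10) (by norm_num)
  exact ⟨⟨(x, r), hx, hr, hr10, hc⟩⟩

/-- The scheme of thick balls. -/
noncomputable def thickScheme (X : Type*) [MetricSpace X] [TopologicalSpace.SeparableSpace X]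
    (hd : 0 < d) : CantorScheme X d (ThickBall X d) where
  center p := p.1.1
  radius p := p.1.2
  children p := (ThickBall.exists_children hd p).choose
  ratio := (4 * 260 ^ d)⁻¹
  ratio_pos := by positivity
  radius_pos p := p.2.2.1
  radius_le p := p.2.2.2.1
  radius_child p q hq := ((ThickBall.exists_children hd p).choose_spec.1 q hq).1
  dist_child p q hq := ((ThickBall.exists_children hd p).choose_spec.1 q hq).2
  separated p := (ThickBall.exists_children hd p).choose_spec.2.1
  packing p := (ThickBall.exists_children hd p).choose_spec.2.2.1
  mass p := (ThickBall.exists_children hd p).choose_spec.2.2.2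

end Construction

theorem mainTheorem5 {X : Type*} [MetricSpace X] [CompleteSpace X]
    [TopologicalSpace.SeparableSpace X] (d : ℝ≥0) (hd : (d : ℝ≥0∞) < dimH (Set.univ : Set X)) :
    ∃ K : Set X, IsCompact K ∧ dimH K = (d : ℝ≥0∞) := by
  rcases eq_or_ne d 0 with rfl | hd0
  · have hne : (Set.univ : Set X).Nonempty := by
      by_contra h
      simp [Set.not_nonempty_iff_eq_empty.1 h] at hd
    obtain ⟨x, -⟩ := hne
    exact ⟨{x}, isCompact_singleton, by simp⟩
  have hpos : 0 < d := pos_iff_ne_zero.2 hd0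
  borelize X
  have hcontent : hausdorffContent X (d : ℝ) Set.univ ≠ 0 := fun h => by
    have h1 := hausdorffMeasure_eq_zero_of_content (NNReal.coe_pos.2 hpos) h
    simp [hausdorffMeasure_of_lt_dimH hd] at h1
  obtain ⟨p₀⟩ := nonempty_thickBall (NNReal.coe_pos.2 hpos) hcontent
  let C := thickScheme X (NNReal.coe_pos.2 hpos)
  exact ⟨C.limitSet p₀, C.isCompact_limitSet p₀, C.dimH_limitSet hpos p₀⟩
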